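/- Let $N\in\mathbb N$, $k>0$, and let $\sigma\in C^{\infty}(\mathbb{R}^{N}\setminus\{0\};(0,\infty))$ be homogeneous of degree $k$, i.e. $\sigma(t\xi)=t^{k}\sigma(\xi)$ for all $t>0$, $\xi\neq 0$. Let $1<\alpha<2$ and $0\le\delta<k$, and let $$E_{\alpha,1}(z)=\sum_{n=0}^{\infty}\frac{z^{n}}{\Gamma(\alpha n+1)},\qquad z\in\mathbb C,$$ be the Mittag-Leffler function. Then $\xi\mapsto|\xi|^{\delta}E_{\alpha,1}(-\sigma(\xi))$ is $C^\infty$ on $\mathbb{R}^{N}\setminus\{0\}$, and there exists a constant $C>0$, depending only on $N,\sigma,k,\alpha,\delta$, such that the following holds. If $A\in\mathbb R$ satisfies $$\left|\frac{\partial^{\gamma}}{\partial\xi^{\gamma}}\sigma(\xi)\right|\le A|\xi|^{k-|\gamma|}\qquad\text{for all }\xi\ne0$$ and all multi-indices $\gamma\in(\mathbb N\cup\{0\})^N$ with $|\gamma|\le[N/2]+1$, then $$\left|\frac{\partial^{\gamma}}{\partial\xi^{\gamma}}\Big[|\xi|^{\delta}E_{\alpha,1}(-\sigma(\xi))\Big]\right|\le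 C A\,|\xi|^{-|\gamma|}\qquad\text{for all }\xi\ne0$$ and all multi-indices $\gamma$ with $|\gamma|\le[N/2]+1$. -/

import Mathlib

open scoped ContDiff

/-- The two-parametric Mittag-Leffler function
`E_{α,β}(z) = ∑_{n ≥ 0} z ^ n / Γ(α n + β)` (the series converges for all `z` when `α, β > 0`). -/
noncomputable def mittagLeffler (α β : ℝ) (z : ℂ) : ℂ :=
  ∑' n : ℕ, z ^ n / (Real.Gamma (α * n + β) : ℂ)

/-- The partial derivative `∂f/∂ξ_i` of a function on `ℝ^N`. -/
noncomputable def partialDeriv {N : ℕ} {F : Type*} [NormedAddCommGroup F] [NormedSpace ℝ F]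
    (i : Fin N) (f : EuclideanSpace ℝ (Fin N) → F) : EuclideanSpace ℝ (Fin N) → F :=
  fun ξ => lineDeriv ℝ f ξ (EuclideanSpace.single i 1)

/-- The partial derivative `∂^γ f = ∂_0^{γ_0} ∂_1^{γ_1} ⋯ ∂_{N-1}^{γ_{N-1}} f` for a
multi-index `γ`. -/
noncomputable def multiDeriv {N : ℕ} {F : Type*} [NormedAddCommGroup F] [NormedSpace ℝ F]
    (γ : Fin N → ℕ) (f : EuclideanSpace ℝ (Fin N) → F) : EuclideanSpace ℝ (Fin N) → F :=
  (List.finRange N).foldr (fun i g => (partialDeriv i)^[γ i] g) f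

/-! The proof is a scaling argument resting on the decay of `E = mittagLeffler α 1` near the
negative axis. Fix ξ and put r = |ξ|. By homogeneity the symbol at η is G_r(η/r), where G_r(x) =
|x|^δ · r^δ E(-r^k σ(x)). Each derivative produces one factor 1/r, so it suffices to bound the
derivatives of G_r on the unit sphere uniformly in r. There σ ≥ a > 0, and σ and |x|^δ have bounded
derivatives by compactness, so only s ↦ r^δ E(-r^k s) on s ≥ a matters. Its derivatives are
controlled by |E^(j)(-s)| ≤ C s^(-j)/(1+s) and δ ≤ k (`exists_bound_dilated_mittagLeffler`).

That decay follows from Cauchy's estimates on discs of radius proportional to s, once E =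
O(1/(1+|z|)) on a cone around the negative axis (`exists_norm_mittagLeffler_le`). The latter comes
from Laplace inversion of 1/Γ on Re ζ = 1: summing the series under the integral gives a rational
kernel in zζ^(-α), whose pole is avoided on the cone because |arg ζ^α| ≤ απ/2 < π.

The constant A enters only at the end: the case γ = 0 of its hypothesis bounds A below by a positive
constant. -/

/-! ### Laplace transform of powers and its inversion -/

open Complex MeasureTheory in
theorem integrableOn_rpow_mul_exp_neg_mul {s c : ℝ} (hs : 0 < s) (hc : 0 < c) :
    IntegrableOn (fun t : ℝ => t ^ (s - 1) * Real.exp (-(c * t))) (Set.Ioi 0) := by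
  have := integrableOn_rpow_mul_exp_neg_mul_rpow (s := s - 1) (p := 1) (b := c) (by linarith)
    one_pos hc
  simpa using this

open Complex MeasureTheory in
theorem aestronglyMeasurable_cpow_mul_exp_neg_mul (s : ℂ) (r : ℂ) :
    AEStronglyMeasurable (fun t : ℝ => (t : ℂ) ^ s * cexp (-(r * t)))
      (volume.restrict (Set.Ioi 0)) := by
  refine ContinuousOn.aestronglyMeasurable (fun t ht => ?_) measurableSet_Ioi
  refine ContinuousAt.continuousWithinAt (ContinuousAt.mul ?_ (by fun_prop))
  exact continuousAt_ofReal_cpow_const _ _ (Or.inr (ne_of_gt ht))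

open Complex MeasureTheory in
/-- The Laplace transform of a real power is holomorphic in the right half-plane. -/
theorem differentiableOn_integral_cpow_mul_exp_neg_mul {s : ℝ} (hs : 0 < s) :
    DifferentiableOn ℂ (fun r : ℂ => ∫ t : ℝ in Set.Ioi 0,
      (t : ℂ) ^ ((s : ℂ) - 1) * cexp (-(r * t))) {r | 0 < r.re} := by
  intro r hr
  have hr : 0 < r.re := hr
  have hnorm : ∀ (q : ℂ), ∀ t ∈ Set.Ioi (0 : ℝ), r.re / 2 < q.re →
      ‖(t : ℂ) ^ ((s : ℂ) - 1) * cexp (-(q * t))‖ ≤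
        t ^ (s - 1) * Real.exp (-(r.re / 2 * t)) := by
    intro q t ht hq
    have ht : 0 < t := ht
    rw [norm_mul, norm_exp, ← ofReal_one, ← ofReal_sub, norm_cpow_real, norm_real,
      Real.norm_of_nonneg ht.le]
    gcongr
    simp
    nlinarith
  -- Domination is uniform on Re q > Re r / 2; differentiating in q costs a factor t, hence the
  -- exponent s + 1 in the bound.
  refine (hasDerivAt_integral_of_dominated_loc_of_deriv_le (𝕜 := ℂ)
    (s := {q | r.re / 2 < q.re}) (x₀ := r)
    (F' := fun q t => (t : ℂ) ^ ((s : ℂ) - 1) * (cexp (-(q * t)) * (-t)))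
    (bound := fun t => t ^ ((s + 1) - 1) * Real.exp (-(r.re / 2 * t))) ?_ ?_ ?_ ?_ ?_ ?_
    ?_).2.differentiableAt.differentiableWithinAt
  · exact (isOpen_lt continuous_const continuous_re).mem_nhds (by simp; linarith)
  · exact Filter.Eventually.of_forall fun q => aestronglyMeasurable_cpow_mul_exp_neg_mul _ _
  · refine Integrable.mono' (integrableOn_rpow_mul_exp_neg_mul hs (half_pos hr))
      (aestronglyMeasurable_cpow_mul_exp_neg_mul _ _) ?_
    exact (ae_restrict_iff' measurableSet_Ioi).2
      (Filter.Eventually.of_forall fun t ht => hnorm r t ht (by linarith))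
  · simp_rw [← mul_assoc]
    exact (aestronglyMeasurable_cpow_mul_exp_neg_mul _ _).mul
      (by fun_prop : Continuous fun t : ℝ => -(t : ℂ)).aestronglyMeasurable
  · refine (ae_restrict_iff' measurableSet_Ioi).2 (Filter.Eventually.of_forall fun t ht q hq => ?_)
    rw [← mul_assoc, norm_mul, norm_neg, norm_real, Real.norm_of_nonneg (le_of_lt ht)]
    calc _ ≤ t ^ (s - 1) * Real.exp (-(r.re / 2 * t)) * t := by
          gcongr
          · exact le_of_lt ht
          · exact hnorm q t ht hq
      _ = _ := by
          have : t ^ (s + 1 - 1) = t ^ (s - 1) * t := by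
            rw [← Real.rpow_add_one (ne_of_gt ht)]
            congr 1; ring
          rw [this]; ring
  · exact integrableOn_rpow_mul_exp_neg_mul (by linarith) (half_pos hr)
  · refine Filter.Eventually.of_forall fun t q _ => HasDerivAt.const_mul _ ?_
    refine HasDerivAt.cexp ?_
    simpa using ((hasDerivAt_id q).mul_const (t : ℂ)).fun_neg

open Complex MeasureTheory in
/-- The Laplace transform of `t ↦ t ^ (s - 1)` in the right half-plane. -/
theorem integral_cpow_mul_exp_neg_mul_of_re_pos {s : ℝ} (hs : 0 < s) {r : ℂ} (hr : 0 < r.re) :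
    ∫ t : ℝ in Set.Ioi 0, (t : ℂ) ^ ((s : ℂ) - 1) * cexp (-(r * t)) =
      r ^ (-(s : ℂ)) * Real.Gamma s := by
  have hopen : IsOpen {r : ℂ | 0 < r.re} := isOpen_lt continuous_const continuous_re
  have h1 := (differentiableOn_integral_cpow_mul_exp_neg_mul hs).analyticOnNhd hopen
  have h2 : AnalyticOnNhd ℂ (fun r : ℂ => r ^ (-(s : ℂ)) * Real.Gamma s) {r : ℂ | 0 < r.re} := by
    refine DifferentiableOn.analyticOnNhd (fun q hq => ?_) hopen
    refine DifferentiableAt.differentiableWithinAt ?_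
    exact (differentiableAt_id.cpow_const (Or.inl hq)).mul_const _
  -- Identity theorem: the formula is known for positive real r, and these accumulate at 1.
  refine h1.eqOn_of_preconnected_of_frequently_eq h2 (convex_halfSpace_re_gt 0).isPreconnected
    (z₀ := 1) (by simp) ?_ hr
  have hfreq : ∃ᶠ x : ℝ in nhdsWithin 1 {1}ᶜ, 0 < x :=
    (Filter.Eventually.filter_mono nhdsWithin_le_nhds
      (Ioi_mem_nhds (show (0 : ℝ) < 1 by norm_num))).frequently
  have htend : Filter.Tendsto (fun x : ℝ => (x : ℂ)) (nhdsWithin 1 {1}ᶜ) (nhdsWithin 1 {1}ᶜ) := by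
    refine tendsto_nhdsWithin_iff.2 ⟨?_, ?_⟩
    · simpa using (continuous_ofReal.tendsto (1 : ℝ)).mono_left nhdsWithin_le_nhds
    · filter_upwards [self_mem_nhdsWithin] with x hx
      simpa using hx
  refine htend.frequently (hfreq.mono fun x hx => ?_)
  rw [Complex.integral_cpow_mul_exp_neg_mul_Ioi (by simpa) hx, Gamma_ofReal, one_div,
    inv_cpow _ _ (by rw [arg_ofReal_of_nonneg hx.le]; exact Real.pi_pos.ne), cpow_neg]

open Complex in
theorem norm_one_add_mul_I (y : ℝ) : ‖(1 + y * I : ℂ)‖ = (1 + ‖y‖ ^ 2) ^ (1 / 2 : ℝ) := by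
  rw [← Real.sqrt_eq_rpow, ← ofReal_one, norm_add_mul_I]
  simp

open Complex in
theorem one_add_mul_I_mem_slitPlane (y : ℝ) : (1 + y * I : ℂ) ∈ slitPlane := by
  left; simp

open Complex in
theorem one_add_mul_I_ne_zero (y : ℝ) : (1 + y * I : ℂ) ≠ 0 :=
  slitPlane_ne_zero (one_add_mul_I_mem_slitPlane y)

open Complex in
theorem one_le_norm_one_add_mul_I (y : ℝ) : 1 ≤ ‖(1 + y * I : ℂ)‖ := by
  simpa using abs_re_le_norm (1 + y * I : ℂ)

open Complex in
theorem continuous_one_add_mul_I_cpow (s : ℂ) : Continuous fun y : ℝ => (1 + y * I : ℂ) ^ s := by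
  refine Continuous.cpow (by fun_prop) continuous_const one_add_mul_I_mem_slitPlane

open Complex MeasureTheory in
theorem integrable_norm_one_add_mul_I_rpow {s : ℝ} (hs : 1 < s) :
    Integrable fun y : ℝ => ‖(1 + y * I : ℂ)‖ ^ (-s) := by
  refine (integrable_rpow_neg_one_add_norm_sq (E := ℝ) (r := s) (by simpa)).congr
    (Filter.Eventually.of_forall fun y => ?_)
  dsimp only
  rw [norm_one_add_mul_I, ← Real.rpow_mul (by positivity)]
  congr 1; ring

open Complex MeasureTheory in
theorem integrable_one_add_mul_I_cpow {s : ℝ} (hs : 1 < s) :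
    Integrable fun y : ℝ => (1 + y * I : ℂ) ^ (-(s : ℂ)) := by
  refine (integrable_norm_one_add_mul_I_rpow hs).mono'
    (continuous_one_add_mul_I_cpow _).aestronglyMeasurable
    (Filter.Eventually.of_forall fun y => ?_)
  rw [← ofReal_neg, norm_cpow_real]

open Complex MeasureTheory in
/-- Laplace inversion of `t ↦ t ^ (s - 1)` at `t = 1`, along the line `Re ζ = 1`. -/
theorem integral_exp_mul_cpow_neg_eq {s : ℝ} (hs : 1 < s) :
    ∫ y : ℝ, cexp (1 + y * I) * (1 + y * I) ^ (-(s : ℂ)) =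
      2 * Real.pi / (Real.Gamma s : ℂ) := by
  -- Fourier inversion is applied to this damped power at t = 1; its transform at w is the Laplace
  -- transform at 1 + 2πiw. The assumption s > 1 makes that transform integrable.
  set f : ℝ → ℂ := Set.indicator (Set.Ioi 0) (fun t : ℝ => (t : ℂ) ^ ((s : ℂ) - 1) * cexp (-t))
    with hf
  have hs0 : 0 < (s : ℂ).re := by rw [ofReal_re]; linarith
  have hΓ : (Real.Gamma s : ℂ) ≠ 0 := ofReal_ne_zero.2 (Real.Gamma_pos_of_pos (by linarith)).ne'
  have hF : ∀ w : ℝ, FourierTransform.fourier f w =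
      (1 + (2 * Real.pi * w : ℝ) * I) ^ (-(s : ℂ)) * Real.Gamma s := by
    intro w
    rw [Real.fourier_real_eq_integral_exp_smul]
    have h1 : ∀ v : ℝ, cexp (↑(-2 * Real.pi * v * w) * I) • f v =
        Set.indicator (Set.Ioi 0) (fun t : ℝ => (t : ℂ) ^ ((s : ℂ) - 1) *
          cexp (-((1 + (2 * Real.pi * w : ℝ) * I) * t))) v := by
      intro v
      by_cases hv : v ∈ Set.Ioi (0 : ℝ)
      · simp only [f, Set.indicator_of_mem hv, smul_eq_mul]
        rw [mul_left_comm, ← Complex.exp_add]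
        congr 2
        push_cast
        ring
      · simp only [f, Set.indicator_of_notMem hv, smul_zero]
    simp_rw [h1]
    rw [integral_indicator measurableSet_Ioi,
      integral_cpow_mul_exp_neg_mul_of_re_pos (by linarith) (by simp)]
  have hint : Integrable f := by
    rw [hf, integrable_indicator_iff measurableSet_Ioi]
    refine (Complex.GammaIntegral_convergent hs0).congr (Filter.Eventually.of_forall fun x => ?_)
    simp [mul_comm]
  have hint2 : Integrable (FourierTransform.fourier f) := by
    have h1 := (((integrable_one_add_mul_I_cpow hs).comp_mul_left' (R := 2 * Real.pi)
      (by positivity)).mul_const (Real.Gamma s : ℂ))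
    refine h1.congr (Filter.Eventually.of_forall fun x => ?_)
    simp [hF]
  have hcont : ContinuousAt f 1 := by
    have : ContinuousAt (fun t : ℝ => (t : ℂ) ^ ((s : ℂ) - 1) * cexp (-t)) 1 :=
      ContinuousAt.mul (continuousAt_ofReal_cpow_const _ _ (Or.inr one_ne_zero)) (by fun_prop)
    refine this.congr ?_
    filter_upwards [Ioi_mem_nhds (show (0 : ℝ) < 1 by norm_num)] with t ht
    simp only [f, Set.indicator_of_mem ht]
  have key := hint.fourierInv_fourier_eq hint2 hcont
  have hf1 : f 1 = cexp (-1) := by simp [f]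
  rw [Real.fourierInv_eq', hf1] at key
  have h3 : ∀ v : ℝ, cexp (↑(2 * Real.pi * inner ℝ v 1) * I) • FourierTransform.fourier f v =
      (fun y : ℝ => (Real.Gamma s * cexp (-1)) * (cexp (1 + y * I) * (1 + y * I) ^ (-(s : ℂ))))
        (2 * Real.pi * v) := by
    intro v
    have : cexp (1 + ↑(2 * Real.pi * v) * I) = cexp 1 * cexp (↑(2 * Real.pi * v) * I) :=
      Complex.exp_add _ _
    simp only [this, hF, smul_eq_mul]
    have h4 : cexp (-1) * cexp 1 = 1 := by rw [← Complex.exp_add]; simp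
    have h5 : (inner ℝ v 1 : ℝ) = v := by simp
    rw [h5]
    linear_combination (-(Real.Gamma s : ℂ) * cexp (↑(2 * Real.pi * v) * I) *
      (1 + ↑(2 * Real.pi * v) * I) ^ (-(s : ℂ))) * h4
  simp_rw [h3] at key
  rw [Measure.integral_comp_mul_left (fun y : ℝ => (Real.Gamma s * cexp (-1)) *
    (cexp (1 + y * I) * (1 + y * I) ^ (-(s : ℂ)))), integral_const_mul,
    abs_of_pos (by positivity), real_smul, ofReal_inv] at key
  have hpi : ((2 * Real.pi : ℝ) : ℂ) ≠ 0 := ofReal_ne_zero.2 (by positivity)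
  have he : cexp (-1) ≠ 0 := Complex.exp_ne_zero _
  rw [eq_div_iff hΓ]
  rw [inv_mul_eq_iff_eq_mul₀ hpi] at key
  refine mul_right_cancel₀ he ?_
  rw [ofReal_mul, ofReal_ofNat] at key
  linear_combination key

/-! ### The rational kernel and the cone around the negative axis -/

/-- The sum of `∑ (α n + 1) (α n + 2) w ^ n`. -/
noncomputable def mittagLefflerKernel (α : ℝ) (w : ℂ) : ℂ :=
  2 * (α : ℂ) ^ 2 * (1 / (1 - w) ^ 3) + (3 * α - 3 * (α : ℂ) ^ 2) * (1 / (1 - w) ^ 2) +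
    ((α : ℂ) ^ 2 - 3 * α + 2) * (1 / (1 - w) ^ 1)

/-- The coefficients of the kernel expand (αn+1)(αn+2) in the binomials C(n+2,2), n+1 and 1, whose
generating functions are powers of 1/(1-w). -/
theorem hasSum_mittagLefflerKernel (α : ℝ) {w : ℂ} (hw : ‖w‖ < 1) :
    HasSum (fun n : ℕ => ((α * n + 1) * (α * n + 2) : ℂ) * w ^ n) (mittagLefflerKernel α w) := by
  have h0 := hasSum_choose_mul_geometric_of_norm_lt_one 0 hw
  have h1 := hasSum_choose_mul_geometric_of_norm_lt_one 1 hw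
  have h2 := hasSum_choose_mul_geometric_of_norm_lt_one 2 hw
  refine (((h2.mul_left (2 * (α : ℂ) ^ 2)).add (h1.mul_left (3 * α - 3 * (α : ℂ) ^ 2))).add
    (h0.mul_left ((α : ℂ) ^ 2 - 3 * α + 2))).congr_fun fun n => ?_
  have hc : (((n + 2).choose 2 : ℕ) : ℂ) = (n + 2) * (n + 1) / 2 := by
    rw [Nat.cast_choose_two]; push_cast; ring
  rw [hc]
  simp
  ring

theorem norm_mittagLefflerKernel_le (α : ℝ) {c : ℝ} (hc : 0 < c) {w : ℂ}
    (hw : c * (1 + ‖w‖) ≤ ‖1 - w‖) :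
    ‖mittagLefflerKernel α w‖ ≤ (‖2 * (α : ℂ) ^ 2‖ / c ^ 3 + ‖3 * α - 3 * (α : ℂ) ^ 2‖ / c ^ 2 +
      ‖(α : ℂ) ^ 2 - 3 * α + 2‖ / c) / (1 + ‖w‖) := by
  have h1 : (1 : ℝ) ≤ 1 + ‖w‖ := by simp
  have hj : ∀ j : ℕ, 1 ≤ j → ‖1 / (1 - w) ^ j‖ ≤ 1 / c ^ j / (1 + ‖w‖) := by
    intro j hj
    rw [norm_div, norm_one, norm_pow, div_div]
    refine one_div_le_one_div_of_le (by positivity) ?_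
    calc c ^ j * (1 + ‖w‖) ≤ c ^ j * (1 + ‖w‖) ^ j := by
          gcongr; exact le_self_pow₀ h1 (by omega)
      _ = (c * (1 + ‖w‖)) ^ j := by rw [mul_pow]
      _ ≤ _ := by gcongr
  unfold mittagLefflerKernel
  refine (norm_add₃_le).trans ?_
  rw [norm_mul (2 * (α : ℂ) ^ 2), norm_mul (3 * α - 3 * (α : ℂ) ^ 2),
    norm_mul ((α : ℂ) ^ 2 - 3 * α + 2)]
  calc _ ≤ ‖2 * (α : ℂ) ^ 2‖ * (1 / c ^ 3 / (1 + ‖w‖)) +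
        ‖3 * α - 3 * (α : ℂ) ^ 2‖ * (1 / c ^ 2 / (1 + ‖w‖)) +
        ‖(α : ℂ) ^ 2 - 3 * α + 2‖ * (1 / c ^ 1 / (1 + ‖w‖)) := by
        gcongr
        · exact hj 3 (by norm_num)
        · exact hj 2 (by norm_num)
        · exact hj 1 (by norm_num)
    _ = _ := by ring

/-- The open convex cone of aperture `ε` around the negative real axis. -/
def negCone (ε : ℝ) : Set ℂ := {z | |z.im| < ε * (-z.re)}

theorem isOpen_negCone (ε : ℝ) : IsOpen (negCone ε) :=
  isOpen_lt (by fun_prop) (by fun_prop)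

theorem convex_negCone (ε : ℝ) : Convex ℝ (negCone ε) := by
  intro x hx y hy a b ha hb hab
  simp only [negCone, Set.mem_ofPred_eq, Complex.add_im, Complex.add_re, Complex.smul_im,
    Complex.smul_re, smul_eq_mul, abs_lt] at *
  rcases ha.eq_or_lt with rfl | ha
  · obtain rfl : b = 1 := by linarith
    constructor <;> linarith
  · constructor <;> nlinarith

/-- A radius proportional to s is what turns Cauchy's estimate into a gain of s^(-j). -/
theorem closedBall_subset_negCone {ε s : ℝ} (hε : 0 < ε) (hε1 : ε < 1) (hs : 0 < s) :
    Metric.closedBall (-(s : ℂ)) (ε / 2 * s) ⊆ negCone ε := by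
  intro z hz
  rw [Metric.mem_closedBall, dist_eq_norm] at hz
  have h1 := (Complex.abs_im_le_norm (z - -(s : ℂ))).trans hz
  have h2 := (Complex.abs_re_le_norm (z - -(s : ℂ))).trans hz
  simp at h1 h2
  have h3 := (abs_le.1 h2).2
  show |z.im| < ε * (-z.re)
  nlinarith [mul_pos hε hs, mul_pos (mul_pos hε hs) (sub_pos.2 hε1)]

open Complex in
/-- The image of the line `Re ζ = 1` under `ζ ↦ ζ ^ α` is separated from a cone around the negative
real axis. -/
theorem exists_negCone_separated {α : ℝ} (hα₁ : 1 < α) (hα₂ : α < 2) :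
    ∃ c > 0, ∃ ε > 0, ε < 1 ∧ ∀ z ∈ negCone ε, ∀ y : ℝ,
      c * (‖(1 + y * I : ℂ) ^ (α : ℂ)‖ + ‖z‖) ≤ ‖(1 + y * I : ℂ) ^ (α : ℂ) - z‖ := by
  set κ := Real.cos (α * (Real.pi / 2)) with hκ
  have hπ := Real.pi_pos
  have hκ1 : -1 < κ := by
    rw [hκ, ← Real.cos_pi]
    exact Real.cos_lt_cos_of_nonneg_of_le_pi (by positivity) le_rfl (by nlinarith)
  have hκ2 : κ ≤ 1 := Real.cos_le_one _
  -- Chosen from a² + 2κab + b² = (1+κ)/2 · (a+b)² + (1-κ)/2 · (a-b)², with a = |u| and b = s. The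
  -- smaller constants c₀/4 and c₀/2 below leave room for Im z.
  set c₀ := Real.sqrt ((1 + κ) / 2) with hc₀
  have hc₀pos : 0 < c₀ := Real.sqrt_pos.2 (by linarith)
  have hc₀sq : c₀ ^ 2 = (1 + κ) / 2 := Real.sq_sqrt (by linarith)
  have hc₀1 : c₀ ≤ 1 := by nlinarith
  refine ⟨c₀ / 4, by positivity, c₀ / 2, by positivity, by linarith, fun z hz y => ?_⟩
  set u := (1 + y * I : ℂ) ^ (α : ℂ) with hu
  have hz : |z.im| < c₀ / 2 * (-z.re) := hz
  set s := -z.re with hs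
  have hspos : 0 < s := by
    have := (abs_nonneg _).trans_lt hz
    exact pos_of_mul_pos_right this (by positivity)
  have hre : ‖u‖ * κ ≤ u.re := by
    have harg : |α * arg (1 + y * I)| ≤ α * (Real.pi / 2) := by
      rw [abs_mul, abs_of_pos (by linarith)]
      gcongr
      exact abs_arg_le_pi_div_two_iff.2 (by simp)
    have h1 : u.re = ‖u‖ * Real.cos (α * arg (1 + y * I)) := by
      rw [hu, cpow_def_of_ne_zero (one_add_mul_I_ne_zero y), exp_re, norm_exp]
      simp [mul_comm, log_im]
    rw [h1]
    gcongr
    rw [hκ, ← Real.cos_abs (α * arg (1 + y * I))]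
    exact Real.cos_le_cos_of_nonneg_of_le_pi (abs_nonneg _) (by nlinarith) harg
  have h2 : c₀ * (‖u‖ + s) ≤ ‖u + s‖ := by
    refine le_of_sq_le_sq ?_ (norm_nonneg _)
    have h3 : ‖u + s‖ ^ 2 = ‖u‖ ^ 2 + 2 * s * u.re + s ^ 2 := by
      rw [← normSq_eq_norm_sq, ← normSq_eq_norm_sq, normSq_apply, normSq_apply]
      simp
      ring
    rw [h3, mul_pow, hc₀sq]
    nlinarith [mul_le_mul_of_nonneg_left hre hspos.le, sq_nonneg (‖u‖ - s),
      mul_nonneg (sub_nonneg.2 hκ2) (sq_nonneg (‖u‖ - s))]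
  have hzs : z = -(s : ℂ) + z.im * I := by
    apply Complex.ext <;> simp [hs]
  have h4 : ‖u + s‖ ≤ ‖u - z‖ + |z.im| := by
    have : u + s = (u - z) + z.im * I := by linear_combination hzs
    rw [this]
    refine (norm_add_le _ _).trans ?_
    simp
  have h5 : ‖z‖ ≤ s + |z.im| := by
    refine (norm_le_abs_re_add_abs_im z).trans ?_
    rw [abs_of_neg (by linarith)]
  have := norm_nonneg u
  nlinarith [mul_nonneg hc₀pos.le (norm_nonneg u), mul_pos hc₀pos hspos, abs_nonneg z.im]

open Complex in
theorem norm_exp_one_add_mul_I (y : ℝ) : ‖cexp (1 + y * I)‖ = Real.exp 1 := by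
  rw [norm_exp]; simp

open Complex in
theorem norm_one_add_mul_I_cpow_neg_le_one (y : ℝ) {s : ℝ} (hs : 0 ≤ s) :
    ‖(1 + y * I : ℂ) ^ (-(s : ℂ))‖ ≤ 1 := by
  rw [← ofReal_neg, norm_cpow_real]
  exact Real.rpow_le_one_of_one_le_of_nonpos (one_le_norm_one_add_mul_I y) (by linarith)

/-! ### Integral representation and decay of the Mittag-Leffler function -/

/-- The integrand of the Laplace-type representation of `E_{α,1}`. -/
noncomputable def mittagLefflerIntegrand (α : ℝ) (z : ℂ) (y : ℝ) : ℂ :=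
  Complex.exp (1 + y * Complex.I) * (1 + y * Complex.I) ^ (-((3 : ℝ) : ℂ)) *
    mittagLefflerKernel α (z * (1 + y * Complex.I) ^ (-(α : ℂ)))

theorem Gamma_add_three {x : ℝ} (hx : 0 ≤ x) :
    Real.Gamma (x + 3) = (x + 2) * (x + 1) * Real.Gamma (x + 1) := by
  rw [show x + 3 = (x + 2) + 1 by ring, Real.Gamma_add_one (by positivity),
    show x + 2 = (x + 1) + 1 by ring, Real.Gamma_add_one (by positivity)]
  ring

-- Writing 1/Γ(αn+1) = (αn+1)(αn+2)/Γ(αn+3) before inverting puts ζ^(-3) in the integrand. This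
-- justifies the interchange of sum and integral, and still leaves the integrable power ζ^(α-3)
-- after a factor |ζ|^α is lost in the decay estimate; a shift by one would not, since 2 - α < 1.
open Complex MeasureTheory in
theorem mittagLeffler_eq_integral_of_norm_lt_one {α : ℝ} (hα : 0 < α) {z : ℂ} (hz : ‖z‖ < 1) :
    2 * Real.pi * mittagLeffler α 1 z = ∫ y, mittagLefflerIntegrand α z y := by
  set T : ℕ → ℝ → ℂ := fun n y => ((α * n + 1) * (α * n + 2) : ℂ) * z ^ n *
    (cexp (1 + y * I) * (1 + y * I) ^ (-((α * n + 3 : ℝ) : ℂ))) with hT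
  have hcoef : ∀ n : ℕ, ‖((α * n + 1) * (α * n + 2) : ℂ)‖ = (α * n + 1) * (α * n + 2) := by
    intro n
    rw [← Real.norm_of_nonneg (show (0 : ℝ) ≤ (α * n + 1) * (α * n + 2) by positivity),
      ← norm_real]
    push_cast
    rfl
  have hcont : ∀ n, Continuous (T n) := fun n =>
    continuous_const.mul ((by fun_prop : Continuous fun y : ℝ => cexp (1 + y * I)).mul
      (continuous_one_add_mul_I_cpow _))
  have hbound : ∀ n y, ‖T n y‖ ≤ ((α * n + 1) * (α * n + 2) * ‖z‖ ^ n) *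
      (Real.exp 1 * ‖(1 + y * I : ℂ)‖ ^ (-(3 : ℝ))) := by
    intro n y
    rw [hT]
    dsimp only
    rw [norm_mul, norm_mul, hcoef, norm_pow, norm_mul, norm_exp_one_add_mul_I, ← ofReal_neg,
      norm_cpow_real]
    gcongr
    · exact one_le_norm_one_add_mul_I y
    · have : 0 ≤ α * n := by positivity
      linarith
  have hbint : Integrable fun y : ℝ => Real.exp 1 * ‖(1 + y * I : ℂ)‖ ^ (-(3 : ℝ)) :=
    (integrable_norm_one_add_mul_I_rpow (by norm_num)).const_mul _
  have hint : ∀ n, Integrable (T n) := fun n =>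
    (hbint.const_mul _).mono' (hcont n).aestronglyMeasurable
      (Filter.Eventually.of_forall (hbound n))
  have hsumm : Summable fun n => ∫ y, ‖T n y‖ := by
    have h1 := (hasSum_mittagLefflerKernel α (w := z) hz).summable.norm
    simp_rw [norm_mul _ (_ ^ _), hcoef, norm_pow] at h1
    refine Summable.of_nonneg_of_le (fun n => integral_nonneg fun y => norm_nonneg _) (fun n => ?_)
      (h1.mul_right (∫ y : ℝ, Real.exp 1 * ‖(1 + y * I : ℂ)‖ ^ (-(3 : ℝ))))
    rw [← integral_const_mul]
    exact integral_mono (hint n).norm (hbint.const_mul _) (hbound n)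
  have key := hasSum_integral_of_summable_integral_norm hint hsumm
  have hterm : ∀ n, ∫ y, T n y = 2 * Real.pi * (z ^ n / (Real.Gamma (α * n + 1) : ℂ)) := by
    intro n
    have hαn : 0 ≤ α * n := by positivity
    rw [hT]
    dsimp only
    rw [integral_const_mul, integral_exp_mul_cpow_neg_eq (by linarith), Gamma_add_three hαn]
    have h1 : (Real.Gamma (α * n + 1) : ℂ) ≠ 0 :=
      ofReal_ne_zero.2 (Real.Gamma_pos_of_pos (by positivity)).ne'
    have h2 : (α * n + 1 : ℂ) ≠ 0 := by exact_mod_cast (show α * n + 1 ≠ 0 by positivity)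
    have h3 : (α * n + 2 : ℂ) ≠ 0 := by exact_mod_cast (show α * n + 2 ≠ 0 by positivity)
    push_cast
    field_simp
  have htsum : ∀ y, ∑' n, T n y = mittagLefflerIntegrand α z y := by
    intro y
    have hw : ‖z * (1 + y * I : ℂ) ^ (-(α : ℂ))‖ < 1 := by
      rw [norm_mul]
      exact (mul_le_of_le_one_right (norm_nonneg _)
        (norm_one_add_mul_I_cpow_neg_le_one y hα.le)).trans_lt hz
    have h1 := (hasSum_mittagLefflerKernel α hw).mul_left
      (cexp (1 + y * I) * (1 + y * I) ^ (-((3 : ℝ) : ℂ)))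
    rw [mittagLefflerIntegrand, ← h1.tsum_eq]
    refine tsum_congr fun n => ?_
    have h2 : (1 + y * I : ℂ) ^ (-((α * n + 3 : ℝ) : ℂ)) =
        (1 + y * I : ℂ) ^ (-((3 : ℝ) : ℂ)) * ((1 + y * I : ℂ) ^ (-(α : ℂ))) ^ n := by
      rw [← cpow_nat_mul, ← cpow_add _ _ (one_add_mul_I_ne_zero y)]
      congr 1
      push_cast
      ring
    rw [hT]
    dsimp only
    rw [h2, mul_pow]
    ring
  simp_rw [htsum, hterm] at key
  rw [← key.tsum_eq, tsum_mul_left, mittagLeffler]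

theorem factorial_le_Gamma {α : ℝ} (hα : 1 ≤ α) (n : ℕ) :
    (n.factorial : ℝ) ≤ Real.Gamma (α * n + 1) := by
  rw [← Real.Gamma_nat_eq_factorial]
  -- Γ is increasing only from 2 on, so n = 0 is separate.
  rcases Nat.eq_zero_or_pos n with rfl | hn
  · simp
  · have h1 : (1 : ℝ) ≤ n := by exact_mod_cast hn
    have h2 : (n : ℝ) ≤ α * n := by nlinarith
    refine Real.Gamma_strictMonoOn_Ici.monotoneOn ?_ ?_ ?_ <;> simp <;> linarith

theorem norm_mittagLeffler_term_le {α : ℝ} (hα : 1 ≤ α) (z : ℂ) (n : ℕ) :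
    ‖z ^ n / (Real.Gamma (α * n + 1) : ℂ)‖ ≤ ‖z‖ ^ n / n.factorial := by
  have h1 := factorial_le_Gamma hα n
  have h2 : (0 : ℝ) < n.factorial := by exact_mod_cast n.factorial_pos
  rw [norm_div, norm_pow, Complex.norm_real, Real.norm_of_nonneg (by linarith)]
  gcongr

theorem differentiable_mittagLeffler {α : ℝ} (hα : 1 ≤ α) :
    Differentiable ℂ (mittagLeffler α 1) := by
  intro z
  have : DifferentiableOn ℂ (mittagLeffler α 1) (Metric.ball 0 (‖z‖ + 1)) := by
    refine Complex.differentiableOn_tsum_of_summable_norm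
      (Real.summable_pow_div_factorial (‖z‖ + 1)) (fun n => by fun_prop) Metric.isOpen_ball ?_
    intro n w hw
    refine (norm_mittagLeffler_term_le hα w n).trans ?_
    have : ‖w‖ ≤ ‖z‖ + 1 := by simpa using (Metric.mem_ball.1 hw).le
    gcongr
  exact this.differentiableAt (Metric.isOpen_ball.mem_nhds (by simp))

/-- The derivative of `mittagLefflerKernel`. -/
noncomputable def mittagLefflerKernelDeriv (α : ℝ) (w : ℂ) : ℂ :=
  2 * (α : ℂ) ^ 2 * (3 / (1 - w) ^ 4) + (3 * α - 3 * (α : ℂ) ^ 2) * (2 / (1 - w) ^ 3) +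
    ((α : ℂ) ^ 2 - 3 * α + 2) * (1 / (1 - w) ^ 2)

theorem hasDerivAt_mittagLefflerKernel (α : ℝ) {w : ℂ} (hw : 1 - w ≠ 0) :
    HasDerivAt (mittagLefflerKernel α) (mittagLefflerKernelDeriv α w) w := by
  have h : ∀ j : ℕ, HasDerivAt (fun w : ℂ => 1 / (1 - w) ^ (j + 1))
      ((j + 1) / (1 - w) ^ (j + 2)) w := by
    intro j
    have h1 := (((hasDerivAt_id' w).const_sub 1).fun_pow (j + 1)).fun_inv (pow_ne_zero _ hw)
    simp only [one_div]
    refine h1.congr_deriv ?_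
    field_simp
    push_cast
    ring
  refine ((((h 2).const_mul (2 * (α : ℂ) ^ 2)).add
    ((h 1).const_mul (3 * α - 3 * (α : ℂ) ^ 2))).add
    ((h 0).const_mul ((α : ℂ) ^ 2 - 3 * α + 2))).congr_deriv ?_
  simp only [mittagLefflerKernelDeriv]
  norm_num

theorem norm_mittagLefflerKernelDeriv_le (α : ℝ) {c : ℝ} (hc : 0 < c) {w : ℂ}
    (hw : c ≤ ‖1 - w‖) :
    ‖mittagLefflerKernelDeriv α w‖ ≤ ‖2 * (α : ℂ) ^ 2‖ * (3 / c ^ 4) +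
      ‖3 * α - 3 * (α : ℂ) ^ 2‖ * (2 / c ^ 3) + ‖(α : ℂ) ^ 2 - 3 * α + 2‖ * (1 / c ^ 2) := by
  unfold mittagLefflerKernelDeriv
  refine (norm_add₃_le).trans ?_
  rw [norm_mul (2 * (α : ℂ) ^ 2), norm_mul (3 * α - 3 * (α : ℂ) ^ 2),
    norm_mul ((α : ℂ) ^ 2 - 3 * α + 2)]
  simp only [norm_div, norm_pow, norm_one, RCLike.norm_ofNat]
  gcongr

theorem continuous_mittagLefflerKernelDeriv_comp (α : ℝ) {w : ℝ → ℂ} (hw : Continuous w)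
    (h : ∀ y, 1 - w y ≠ 0) : Continuous fun y => mittagLefflerKernelDeriv α (w y) := by
  unfold mittagLefflerKernelDeriv
  have h' : ∀ (j : ℕ) y, (1 - w y) ^ j ≠ 0 := fun j y => pow_ne_zero _ (h y)
  fun_prop (disch := exact fun y => h' _ y)

theorem continuous_mittagLefflerKernel_comp (α : ℝ) {w : ℝ → ℂ} (hw : Continuous w)
    (h : ∀ y, 1 - w y ≠ 0) : Continuous fun y => mittagLefflerKernel α (w y) := by
  unfold mittagLefflerKernel
  have h' : ∀ (j : ℕ) y, (1 - w y) ^ j ≠ 0 := fun j y => pow_ne_zero _ (h y)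
  fun_prop (disch := exact fun y => h' _ y)

open Complex MeasureTheory in
/-- On a cone around the negative real axis, `E_{α,1}` with `1 < α < 2` is `O(1 / (1 + |z|))`. -/
theorem exists_norm_mittagLeffler_le {α : ℝ} (hα₁ : 1 < α) (hα₂ : α < 2) :
    ∃ ε > 0, ε < 1 ∧ ∃ C > 0, ∀ z ∈ negCone ε, ‖mittagLeffler α 1 z‖ * (1 + ‖z‖) ≤ C := by
  obtain ⟨c, hc, ε, hε, hε1, hsep⟩ := exists_negCone_separated hα₁ hα₂
  set w : ℂ → ℝ → ℂ := fun z y => z * (1 + y * I) ^ (-(α : ℂ)) with hw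
  have hnw : ∀ z y, ‖w z y‖ = ‖z‖ * ‖(1 + y * I : ℂ)‖ ^ (-α) := by
    intro z y
    rw [hw]
    dsimp only
    rw [norm_mul, ← ofReal_neg, norm_cpow_real]
  have hsepw : ∀ z ∈ negCone ε, ∀ y, c * (1 + ‖w z y‖) ≤ ‖1 - w z y‖ := by
    intro z hz y
    have hu : (1 + y * I : ℂ) ^ (α : ℂ) ≠ 0 := by
      rw [cpow_ne_zero_iff_of_exponent_ne_zero (by exact_mod_cast (by linarith : α ≠ 0))]
      exact one_add_mul_I_ne_zero y
    have hwz : w z y = z / (1 + y * I : ℂ) ^ (α : ℂ) := by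
      rw [hw]
      dsimp only
      rw [cpow_neg, div_eq_mul_inv]
    have hun : 0 < ‖(1 + y * I : ℂ) ^ (α : ℂ)‖ := norm_pos_iff.2 hu
    have h1 : 1 - w z y = ((1 + y * I : ℂ) ^ (α : ℂ) - z) / (1 + y * I : ℂ) ^ (α : ℂ) := by
      rw [hwz]; field_simp
    rw [h1, hwz, norm_div, norm_div, le_div_iff₀ hun]
    refine le_trans (le_of_eq ?_) (hsep z hz y)
    field_simp
  have hsepc : ∀ z ∈ negCone ε, ∀ y, c ≤ ‖1 - w z y‖ := fun z hz y =>
    le_trans (le_mul_of_one_le_right hc.le (by simp)) (hsepw z hz y)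
  have hne : ∀ z ∈ negCone ε, ∀ y, 1 - w z y ≠ 0 := fun z hz y =>
    norm_pos_iff.1 (hc.trans_le (hsepc z hz y))
  have hwcont : ∀ z, Continuous (w z) := fun z =>
    continuous_const.mul (continuous_one_add_mul_I_cpow _)
  have hpre : Continuous fun y : ℝ => cexp (1 + y * I) * (1 + y * I) ^ (-((3 : ℝ) : ℂ)) :=
    (by fun_prop : Continuous fun y : ℝ => cexp (1 + y * I)).mul (continuous_one_add_mul_I_cpow _)
  have hpren : ∀ y : ℝ, ‖cexp (1 + y * I) * (1 + y * I) ^ (-((3 : ℝ) : ℂ))‖ =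
      Real.exp 1 * ‖(1 + y * I : ℂ)‖ ^ (-(3 : ℝ)) := fun y => by
    rw [norm_mul, norm_exp_one_add_mul_I, ← ofReal_neg, norm_cpow_real]
  have hcont : ∀ z ∈ negCone ε, Continuous (mittagLefflerIntegrand α z) := fun z hz =>
    hpre.mul (continuous_mittagLefflerKernel_comp α (hwcont z) (hne z hz))
  obtain ⟨K, hK0, hK⟩ : ∃ K ≥ 0, ∀ z ∈ negCone ε, ∀ y,
      ‖mittagLefflerKernel α (w z y)‖ ≤ K / (1 + ‖w z y‖) :=
    ⟨_, by positivity, fun z hz y => norm_mittagLefflerKernel_le α hc (hsepw z hz y)⟩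
  obtain ⟨D, hD⟩ : ∃ D, ∀ z ∈ negCone ε, ∀ y, ‖mittagLefflerKernelDeriv α (w z y)‖ ≤ D :=
    ⟨_, fun z hz y => norm_mittagLefflerKernelDeriv_le α hc (hsepc z hz y)⟩
  have hI3 : Integrable fun y : ℝ => ‖(1 + y * I : ℂ)‖ ^ (-(3 : ℝ)) :=
    integrable_norm_one_add_mul_I_rpow (by norm_num)
  have hIα : Integrable fun y : ℝ => ‖(1 + y * I : ℂ)‖ ^ (-(3 - α)) :=
    integrable_norm_one_add_mul_I_rpow (by linarith)
  have hb1 : ∀ z ∈ negCone ε, ∀ y, ‖mittagLefflerIntegrand α z y‖ ≤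
      Real.exp 1 * K * ‖(1 + y * I : ℂ)‖ ^ (-(3 : ℝ)) := by
    intro z hz y
    rw [mittagLefflerIntegrand, norm_mul, hpren]
    have : ‖mittagLefflerKernel α (w z y)‖ ≤ K :=
      (hK z hz y).trans (div_le_self hK0 (by simp))
    calc _ ≤ Real.exp 1 * ‖(1 + y * I : ℂ)‖ ^ (-(3 : ℝ)) * K := by gcongr
      _ = _ := by ring
  -- The decay in z: |z| = |w||ζ|^α, and |w| is absorbed by the kernel bound K/(1+|w|). The
  -- remaining |ζ|^(α-3) is integrable exactly because α < 2.
  have hb2 : ∀ z ∈ negCone ε, ∀ y, ‖z‖ * ‖mittagLefflerIntegrand α z y‖ ≤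
      Real.exp 1 * K * ‖(1 + y * I : ℂ)‖ ^ (-(3 - α)) := by
    intro z hz y
    rw [mittagLefflerIntegrand, norm_mul, hpren]
    have hζ : 0 < ‖(1 + y * I : ℂ)‖ := norm_pos_iff.2 (one_add_mul_I_ne_zero y)
    have h1 : ‖z‖ = ‖w z y‖ * ‖(1 + y * I : ℂ)‖ ^ α := by
      rw [hnw, mul_assoc, ← Real.rpow_add hζ]; simp
    have h2 : ‖w z y‖ * ‖mittagLefflerKernel α (w z y)‖ ≤ K := by
      calc _ ≤ ‖w z y‖ * (K / (1 + ‖w z y‖)) := by gcongr; exact hK z hz y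
        _ = K * (‖w z y‖ / (1 + ‖w z y‖)) := by ring
        _ ≤ K * 1 := by
          gcongr
          rw [div_le_one (by positivity)]
          linarith
        _ = K := mul_one _
    have h3 : ‖(1 + y * I : ℂ)‖ ^ (-(3 - α)) =
        ‖(1 + y * I : ℂ)‖ ^ α * ‖(1 + y * I : ℂ)‖ ^ (-(3 : ℝ)) := by
      rw [← Real.rpow_add hζ]; congr 1; ring
    calc _ = Real.exp 1 * (‖w z y‖ * ‖mittagLefflerKernel α (w z y)‖) *
          ‖(1 + y * I : ℂ)‖ ^ (-(3 - α)) := by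
          rw [h3, h1]; ring
      _ ≤ _ := by gcongr
  have hint : ∀ z ∈ negCone ε, Integrable (mittagLefflerIntegrand α z) := fun z hz =>
    (hI3.const_mul (Real.exp 1 * K)).mono' (hcont z hz).aestronglyMeasurable
      (Filter.Eventually.of_forall (hb1 z hz))
  have hdiff : DifferentiableOn ℂ (fun z => ∫ y, mittagLefflerIntegrand α z y) (negCone ε) := by
    intro z hz
    have hnhds := (isOpen_negCone ε).mem_nhds hz
    refine (hasDerivAt_integral_of_dominated_loc_of_deriv_le (𝕜 := ℂ) (s := negCone ε)
      (F' := fun (z : ℂ) (y : ℝ) => cexp (1 + y * I) * (1 + y * I) ^ (-((3 : ℝ) : ℂ)) *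
        (mittagLefflerKernelDeriv α (w z y) * (1 + y * I) ^ (-(α : ℂ))))
      (bound := fun y : ℝ => Real.exp 1 * ‖(1 + y * I : ℂ)‖ ^ (-(3 : ℝ)) * (D * 1))
      hnhds ?_ (hint z hz) ?_ ?_ ?_ ?_).2.differentiableAt.differentiableWithinAt
    · filter_upwards [hnhds] with q hq using (hcont q hq).aestronglyMeasurable
    · exact (hpre.mul ((continuous_mittagLefflerKernelDeriv_comp α (hwcont z) (hne z hz)).mul
        (continuous_one_add_mul_I_cpow _))).aestronglyMeasurable
    · refine Filter.Eventually.of_forall fun y q hq => ?_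
      rw [norm_mul, hpren, norm_mul]
      have := (norm_nonneg _).trans (hD q hq y)
      gcongr
      · exact hD q hq y
      · exact norm_one_add_mul_I_cpow_neg_le_one y (by linarith)
    · exact (hI3.const_mul _).mul_const _
    · refine Filter.Eventually.of_forall fun y q hq => HasDerivAt.const_mul _ ?_
      exact (hasDerivAt_mittagLefflerKernel α (hne q hq y)).comp q
        (by simpa using (hasDerivAt_id q).mul_const ((1 + y * I : ℂ) ^ (-(α : ℂ))))
  -- The representation is known on the unit disc; both sides are analytic on the convex cone, which
  -- meets the disc at -1/2.
  have hrep : Set.EqOn (fun z => 2 * Real.pi * mittagLeffler α 1 z)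
      (fun z => ∫ y, mittagLefflerIntegrand α z y) (negCone ε) := by
    refine AnalyticOnNhd.eqOn_of_preconnected_of_eventuallyEq (𝕜 := ℂ)
      (((differentiable_mittagLeffler hα₁.le).const_mul _).differentiableOn.analyticOnNhd
        (isOpen_negCone ε)) (hdiff.analyticOnNhd (isOpen_negCone ε))
      (convex_negCone ε).isPreconnected (z₀ := -((1 / 2 : ℝ) : ℂ)) ?_ ?_
    · exact closedBall_subset_negCone hε hε1 (by norm_num)
        (Metric.mem_closedBall_self (by positivity))
    · have : Metric.ball (0 : ℂ) 1 ∈ nhds (-((1 / 2 : ℝ) : ℂ)) :=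
        Metric.isOpen_ball.mem_nhds (by simp; norm_num)
      filter_upwards [this] with q hq
      exact mittagLeffler_eq_integral_of_norm_lt_one (by linarith) (by simpa using hq)
  refine ⟨ε, hε, hε1, Real.exp 1 * K * (∫ y : ℝ, ‖(1 + y * I : ℂ)‖ ^ (-(3 : ℝ))) +
    Real.exp 1 * K * (∫ y : ℝ, ‖(1 + y * I : ℂ)‖ ^ (-(3 - α))) + 1, ?_, fun z hz => ?_⟩
  · have h1 : 0 ≤ ∫ y : ℝ, ‖(1 + y * I : ℂ)‖ ^ (-(3 : ℝ)) :=
      integral_nonneg fun y => by positivity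
    have h2 : 0 ≤ ∫ y : ℝ, ‖(1 + y * I : ℂ)‖ ^ (-(3 - α)) :=
      integral_nonneg fun y => by positivity
    positivity
  · have h1 : ‖mittagLeffler α 1 z‖ ≤ ‖∫ y, mittagLefflerIntegrand α z y‖ := by
      have hrepz : 2 * Real.pi * mittagLeffler α 1 z = ∫ y, mittagLefflerIntegrand α z y :=
        hrep hz
      rw [← hrepz, norm_mul]
      refine le_mul_of_one_le_left (norm_nonneg _) ?_
      rw [norm_mul, norm_real, Real.norm_of_nonneg Real.pi_pos.le, RCLike.norm_ofNat]
      nlinarith [Real.pi_gt_three]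
    have h2 : ‖∫ y, mittagLefflerIntegrand α z y‖ ≤ ∫ y, ‖mittagLefflerIntegrand α z y‖ :=
      norm_integral_le_integral_norm _
    have h3 : ∫ y, ‖mittagLefflerIntegrand α z y‖ ≤
        Real.exp 1 * K * (∫ y : ℝ, ‖(1 + y * I : ℂ)‖ ^ (-(3 : ℝ))) := by
      rw [← integral_const_mul]
      exact integral_mono (hint z hz).norm (hI3.const_mul _) (hb1 z hz)
    have h4 : ‖z‖ * ∫ y, ‖mittagLefflerIntegrand α z y‖ ≤
        Real.exp 1 * K * (∫ y : ℝ, ‖(1 + y * I : ℂ)‖ ^ (-(3 - α))) := by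
      rw [← integral_const_mul, ← integral_const_mul]
      exact integral_mono ((hint z hz).norm.const_mul _) (hIα.const_mul _) (hb2 z hz)
    have h5 : ‖z‖ * ‖mittagLeffler α 1 z‖ ≤ ‖z‖ * ∫ y, ‖mittagLefflerIntegrand α z y‖ := by
      gcongr; exact h1.trans h2
    nlinarith

/-- Cauchy estimates: the derivatives of `E_{α,1}` on the negative real axis decay like
`s ^ (-j) / (1 + s)`. -/
theorem exists_norm_iteratedDeriv_mittagLeffler_le {α : ℝ} (hα₁ : 1 < α) (hα₂ : α < 2) (j : ℕ) :
    ∃ C > 0, ∀ s : ℝ, 0 < s →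
      s ^ j * (1 + s) * ‖iteratedDeriv j (mittagLeffler α 1) (-(s : ℂ))‖ ≤ C := by
  obtain ⟨ε, hε, hε1, C, hC, hbound⟩ := exists_norm_mittagLeffler_le hα₁ hα₂
  refine ⟨j.factorial * (2 * C) / (ε / 2) ^ j, by positivity, fun s hs => ?_⟩
  have h1 := Complex.norm_iteratedDeriv_le_of_forall_mem_sphere_norm_le (c := -(s : ℂ))
    (R := ε / 2 * s) (C := 2 * C / (1 + s)) (f := mittagLeffler α 1) j (by positivity)
    (differentiable_mittagLeffler hα₁.le).diffContOnCl ?_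
  · calc s ^ j * (1 + s) * ‖iteratedDeriv j (mittagLeffler α 1) (-(s : ℂ))‖
        ≤ s ^ j * (1 + s) * (j.factorial * (2 * C / (1 + s)) / (ε / 2 * s) ^ j) := by gcongr
      _ = _ := by
        rw [mul_pow]
        field_simp
  · intro z hz
    have h2 := hbound z (closedBall_subset_negCone hε hε1 hs (Metric.sphere_subset_closedBall hz))
    rw [mem_sphere_iff_norm] at hz
    -- Since ε < 1, this gives |z| ≥ s/2 on the circle, whence the factor 2 in 2C/(1+s).
    have h3 : s ≤ ‖z‖ + ε / 2 * s := by
      have : ‖(s : ℂ)‖ ≤ ‖z‖ + ‖z - -(s : ℂ)‖ := by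
        have := norm_sub_le (z - -(s : ℂ)) z
        rw [show z - -(s : ℂ) - z = (s : ℂ) by ring] at this
        linarith
      rwa [hz, Complex.norm_real, Real.norm_of_nonneg hs.le] at this
    rw [le_div_iff₀ (by positivity)]
    have h4 : 1 + s ≤ 2 * (1 + ‖z‖) := by nlinarith
    nlinarith [norm_nonneg (mittagLeffler α 1 z),
      mul_le_mul_of_nonneg_left h4 (norm_nonneg (mittagLeffler α 1 z))]

/-! ### Partial derivatives bounded by Fréchet derivatives -/

theorem ContDiffOn.partialDeriv {N : ℕ} {F : Type*} [NormedAddCommGroup F] [NormedSpace ℝ F]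
    {f : EuclideanSpace ℝ (Fin N) → F} {U : Set (EuclideanSpace ℝ (Fin N))} (hU : IsOpen U)
    (hf : ContDiffOn ℝ ∞ f U) (i : Fin N) : ContDiffOn ℝ ∞ (partialDeriv i f) U := by
  have h1 : ContDiffOn ℝ ∞ (fun x => fderiv ℝ f x (EuclideanSpace.single i 1)) U :=
    (hf.fderiv_of_isOpen hU (by simp)).clm_apply contDiffOn_const
  refine h1.congr fun x hx => ?_
  exact ((hf.contDiffAt (hU.mem_nhds hx)).differentiableAt (by simp)).lineDeriv_eq_fderiv

/-- A partial derivative is the Fréchet derivative evaluated at a unit vector, and this evaluation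
has norm at most 1. Keeping n arbitrary lets the bound be iterated. -/
theorem norm_iteratedFDeriv_partialDeriv_le {N : ℕ} {F : Type*} [NormedAddCommGroup F]
    [NormedSpace ℝ F] {f : EuclideanSpace ℝ (Fin N) → F} {U : Set (EuclideanSpace ℝ (Fin N))}
    (hU : IsOpen U) (hf : ContDiffOn ℝ ∞ f U) (i : Fin N) (n : ℕ) {x : EuclideanSpace ℝ (Fin N)}
    (hx : x ∈ U) :
    ‖iteratedFDeriv ℝ n (partialDeriv i f) x‖ ≤ ‖iteratedFDeriv ℝ (n + 1) f x‖ := by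
  set L : (EuclideanSpace ℝ (Fin N) →L[ℝ] F) →L[ℝ] F :=
    ContinuousLinearMap.apply ℝ F (EuclideanSpace.single i (1 : ℝ)) with hL
  have heq : partialDeriv i f =ᶠ[nhds x] L ∘ fderiv ℝ f := by
    filter_upwards [hU.mem_nhds hx] with y hy
    exact ((hf.contDiffAt (hU.mem_nhds hy)).differentiableAt (by simp)).lineDeriv_eq_fderiv
  have hLn : ‖L‖ ≤ 1 := by
    refine ContinuousLinearMap.opNorm_le_bound _ zero_le_one fun g => ?_
    simpa [hL] using g.le_opNorm (EuclideanSpace.single i (1 : ℝ))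
  rw [(heq.iteratedFDeriv ℝ n).eq_of_nhds]
  have hfd : ContDiffAt ℝ ∞ (fderiv ℝ f) x :=
    (hf.contDiffAt (hU.mem_nhds hx)).fderiv_right (by simp)
  refine (L.norm_iteratedFDeriv_comp_left hfd (by exact_mod_cast le_top)).trans ?_
  rw [norm_iteratedFDeriv_fderiv]
  exact mul_le_of_le_one_left (norm_nonneg _) hLn

theorem iterate_partialDeriv_bound {N : ℕ} {F : Type*} [NormedAddCommGroup F]
    [NormedSpace ℝ F] {f : EuclideanSpace ℝ (Fin N) → F} {U : Set (EuclideanSpace ℝ (Fin N))}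
    (hU : IsOpen U) (hf : ContDiffOn ℝ ∞ f U) (i : Fin N) (m : ℕ) :
    ContDiffOn ℝ ∞ ((partialDeriv i)^[m] f) U ∧ ∀ n, ∀ x ∈ U,
      ‖iteratedFDeriv ℝ n ((partialDeriv i)^[m] f) x‖ ≤ ‖iteratedFDeriv ℝ (n + m) f x‖ := by
  induction m with
  | zero => exact ⟨hf, fun n x _ => le_rfl⟩
  | succ m ih =>
    rw [Function.iterate_succ_apply']
    refine ⟨ih.1.partialDeriv hU i, fun n x hx => ?_⟩
    refine (norm_iteratedFDeriv_partialDeriv_le hU ih.1 i n hx).trans ((ih.2 _ x hx).trans ?_)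
    rw [show n + 1 + m = n + (m + 1) by ring]

theorem foldr_partialDeriv_bound {N : ℕ} {F : Type*} [NormedAddCommGroup F]
    [NormedSpace ℝ F] {f : EuclideanSpace ℝ (Fin N) → F} {U : Set (EuclideanSpace ℝ (Fin N))}
    (hU : IsOpen U) (hf : ContDiffOn ℝ ∞ f U) (γ : Fin N → ℕ) (l : List (Fin N)) :
    ContDiffOn ℝ ∞ (l.foldr (fun i g => (partialDeriv i)^[γ i] g) f) U ∧ ∀ n, ∀ x ∈ U,
      ‖iteratedFDeriv ℝ n (l.foldr (fun i g => (partialDeriv i)^[γ i] g) f) x‖ ≤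
        ‖iteratedFDeriv ℝ (n + (l.map γ).sum) f x‖ := by
  induction l with
  | nil => exact ⟨hf, fun n x _ => le_rfl⟩
  | cons i l ih =>
    rw [List.foldr_cons, List.map_cons, List.sum_cons]
    obtain ⟨h1, h2⟩ := iterate_partialDeriv_bound hU ih.1 i (γ i)
    refine ⟨h1, fun n x hx => (h2 n x hx).trans ((ih.2 _ x hx).trans ?_)⟩
    rw [add_assoc]

theorem norm_multiDeriv_le {N : ℕ} {F : Type*} [NormedAddCommGroup F]
    [NormedSpace ℝ F] {f : EuclideanSpace ℝ (Fin N) → F} {U : Set (EuclideanSpace ℝ (Fin N))}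
    (hU : IsOpen U) (hf : ContDiffOn ℝ ∞ f U) (γ : Fin N → ℕ) {x : EuclideanSpace ℝ (Fin N)}
    (hx : x ∈ U) : ‖multiDeriv γ f x‖ ≤ ‖iteratedFDeriv ℝ (∑ i, γ i) f x‖ := by
  have h := (foldr_partialDeriv_bound hU hf γ (List.finRange N)).2 0 x hx
  rwa [norm_iteratedFDeriv_zero, zero_add, ← Fin.sum_univ_def] at h

/-! ### Uniform bounds for the dilated symbols on the unit sphere -/

theorem iteratedDeriv_comp_neg_mul_ofReal {f : ℂ → ℂ} (hf : Differentiable ℂ f) (c : ℝ) (n : ℕ) :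
    iteratedDeriv n (fun s : ℝ => f (-((c * s : ℝ) : ℂ))) =
      fun s : ℝ => (-(c : ℂ)) ^ n * iteratedDeriv n f (-((c * s : ℝ) : ℂ)) := by
  induction n with
  | zero => simp
  | succ n ih =>
    rw [iteratedDeriv_succ, ih]
    funext s
    have h1 : HasDerivAt (iteratedDeriv n f) (iteratedDeriv (n + 1) f (-((c * s : ℝ) : ℂ)))
        (-((c * s : ℝ) : ℂ)) := by
      rw [iteratedDeriv_succ]
      exact ((hf.contDiff (n := ∞)).differentiable_iteratedDeriv n
        (by exact_mod_cast WithTop.coe_lt_top n)).differentiableAt.hasDerivAt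
    have h2 : HasDerivAt (fun s : ℝ => -((c * s : ℝ) : ℂ)) (-(c : ℂ)) s := by
      have := (((hasDerivAt_id s).const_mul c).ofReal_comp).fun_neg
      simpa using this
    have h3 := (h1.comp_of_eq s h2 rfl).const_mul ((-(c : ℂ)) ^ n)
    rw [show (fun s : ℝ => (-(c : ℂ)) ^ n * iteratedDeriv n f (-((c * s : ℝ) : ℂ))) =
      fun s : ℝ => (-(c : ℂ)) ^ n * ((iteratedDeriv n f) ∘ fun s : ℝ => -((c * s : ℝ) : ℂ)) s
      from rfl, h3.deriv]
    ring

theorem rpow_le_one_add_rpow {r δ k : ℝ} (hr : 0 < r) (hδ : 0 ≤ δ) (hδk : δ ≤ k) :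
    r ^ δ ≤ 1 + r ^ k := by
  have hk : 0 < r ^ k := Real.rpow_pos_of_pos hr k
  rcases le_total r 1 with h | h
  · have := Real.rpow_le_one hr.le h hδ
    linarith
  · have := Real.rpow_le_rpow_of_exponent_le h hδk
    linarith

theorem contDiff_mittagLeffler_ofReal {α : ℝ} (hα : 1 ≤ α) (c : ℝ) :
    ContDiff ℝ ∞ fun s : ℝ => mittagLeffler α 1 (-((c * s : ℝ) : ℂ)) := by
  have h1 : ContDiff ℝ ∞ (mittagLeffler α 1) :=
    ((differentiable_mittagLeffler hα).contDiff (n := ∞)).restrict_scalars ℝ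
  have h2 : ContDiff ℝ ∞ fun s : ℝ => -((c * s : ℝ) : ℂ) :=
    (Complex.ofRealCLM.contDiff.comp (contDiff_const.mul contDiff_id)).neg
  exact h1.comp h2

/-- The dilates `s ↦ r ^ δ E_{α,1}(-r ^ k s)` have derivatives bounded uniformly in `r` on
`[a, ∞)`. -/
theorem exists_bound_dilated_mittagLeffler {α : ℝ} (hα₁ : 1 < α) (hα₂ : α < 2) {δ k a : ℝ}
    (hδ : 0 ≤ δ) (hδk : δ ≤ k) (ha : 0 < a) (n : ℕ) :
    ∃ C > 0, ∀ i ≤ n, ∀ r > 0, ∀ s ≥ a, ‖iteratedDeriv i (fun s : ℝ =>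
      ((r ^ δ : ℝ) : ℂ) * mittagLeffler α 1 (-((r ^ k * s : ℝ) : ℂ))) s‖ ≤ C := by
  choose C hC hbound using fun j => exists_norm_iteratedDeriv_mittagLeffler_le hα₁ hα₂ j
  have hpos : ∀ i, 0 < C i / a ^ i * (1 + 1 / a) := fun i => by have := hC i; positivity
  refine ⟨∑ i ∈ Finset.range (n + 1), C i / a ^ i * (1 + 1 / a),
    Finset.sum_pos (fun i _ => hpos i) (by simp), fun i hi r hr s hs => ?_⟩
  refine le_trans ?_ (Finset.single_le_sum (f := fun i => C i / a ^ i * (1 + 1 / a))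
    (fun i _ => (hpos i).le) (Finset.mem_range.2 (Nat.lt_succ_of_le hi)))
  have hs0 : 0 < s := ha.trans_le hs
  have hc : 0 < r ^ k := Real.rpow_pos_of_pos hr k
  have hd : 0 < r ^ δ := Real.rpow_pos_of_pos hr δ
  rw [iteratedDeriv_const_mul_field, iteratedDeriv_comp_neg_mul_ofReal
    (differentiable_mittagLeffler hα₁.le), norm_mul, norm_mul, norm_pow, norm_neg,
    Complex.norm_real, Complex.norm_real, Real.norm_of_nonneg hc.le, Real.norm_of_nonneg hd.le]
  have h1 := hbound i (r ^ k * s) (by positivity)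
  set X := ‖iteratedDeriv i (mittagLeffler α 1) (-((r ^ k * s : ℝ) : ℂ))‖
  have hX : 0 ≤ X := norm_nonneg _
  -- The growth r^δ is paid for by the factor 1 + r^k s in the decay estimate; this is where δ ≤ k
  -- and s ≥ a enter.
  have h2 : r ^ δ ≤ (1 + 1 / a) * (1 + r ^ k * s) := by
    refine (rpow_le_one_add_rpow hr hδ hδk).trans ?_
    have h3 : r ^ k ≤ 1 / a * (r ^ k * s) := by
      rw [one_div, inv_mul_eq_div, le_div_iff₀ ha]
      gcongr
    have h4 : 0 < 1 / a := by positivity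
    nlinarith [mul_pos hc hs0]
  have h5 : a ^ i ≤ s ^ i := by gcongr
  calc r ^ δ * ((r ^ k) ^ i * X)
      ≤ ((1 + 1 / a) * (1 + r ^ k * s)) * ((r ^ k) ^ i * X) := by gcongr
    _ = (1 + 1 / a) * ((r ^ k * s) ^ i * (1 + r ^ k * s) * X) / s ^ i := by
        rw [mul_pow]; field_simp
    _ ≤ (1 + 1 / a) * C i / a ^ i := by
        have := hC i
        gcongr
    _ = _ := by ring

theorem exists_bound_iteratedFDerivWithin_sphere {E F : Type*} [NormedAddCommGroup E]
    [NormedSpace ℝ E] [FiniteDimensional ℝ E] [NormedAddCommGroup F] [NormedSpace ℝ F] {f : E → F}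
    (hf : ContDiffOn ℝ ∞ f {0}ᶜ) (n : ℕ) :
    ∃ B ≥ 1, ∀ i ≤ n, ∀ x, ‖x‖ = 1 → ‖iteratedFDerivWithin ℝ i f {0}ᶜ x‖ ≤ B := by
  have hsub : Metric.sphere (0 : E) 1 ⊆ {0}ᶜ := fun x hx h => by
    rw [Set.mem_singleton_iff.1 h] at hx
    simp at hx
  have h1 : ∀ i : ℕ, ∃ B, ∀ x ∈ Metric.sphere (0 : E) 1,
      ‖iteratedFDerivWithin ℝ i f {0}ᶜ x‖ ≤ B := fun i =>
    (isCompact_sphere (0 : E) 1).exists_bound_of_continuousOn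
      ((hf.continuousOn_iteratedFDerivWithin (by exact_mod_cast le_top)
        isOpen_compl_singleton.uniqueDiffOn).mono hsub)
  choose B hB using h1
  -- The summand 1 gives B ≥ 1, so that B ≤ B^l in the form the bound for iterated derivatives of a
  -- composition requires.
  refine ⟨1 + ∑ i ∈ Finset.range (n + 1), |B i|, by
    have := Finset.sum_nonneg fun i (_ : i ∈ Finset.range (n + 1)) => abs_nonneg (B i)
    linarith, fun i hi x hx => ?_⟩
  have h2 := Finset.single_le_sum (f := fun i => |B i|) (fun i _ => abs_nonneg _)
    (Finset.mem_range.2 (Nat.lt_succ_of_le hi))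
  have h3 := (hB i x (by simpa using hx)).trans (le_abs_self _)
  linarith

theorem contDiffOn_norm_rpow {E : Type*} [NormedAddCommGroup E] [InnerProductSpace ℝ E] (δ : ℝ) :
    ContDiffOn ℝ ∞ (fun x : E => ((‖x‖ ^ δ : ℝ) : ℂ)) {0}ᶜ := by
  intro x hx
  have hx : x ≠ 0 := hx
  refine ContDiffAt.contDiffWithinAt ?_
  exact Complex.ofRealCLM.contDiff.contDiffAt.comp x
    ((contDiffAt_norm ℝ hx).rpow_const_of_ne (norm_ne_zero_iff.2 hx))

/-- The parameter r occurs only in the outer function of one variable, whose derivatives are bounded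
uniformly in r on s ≥ a; the factors depending on x are independent of r and controlled by
compactness. -/
theorem exists_bound_dilated_symbol {E : Type*} [NormedAddCommGroup E] [InnerProductSpace ℝ E]
    [FiniteDimensional ℝ E] {σ : E → ℝ} (hσ : ContDiffOn ℝ ∞ σ {0}ᶜ)
    (hpos : ∀ ξ, ξ ≠ 0 → 0 < σ ξ) {α : ℝ} (hα₁ : 1 < α) (hα₂ : α < 2) {δ k : ℝ}
    (hδ : 0 ≤ δ) (hδk : δ ≤ k) (n : ℕ) :
    ∃ C > 0, ∀ i ≤ n, ∀ r > 0, ∀ x, ‖x‖ = 1 → ‖iteratedFDerivWithin ℝ i (fun η : E =>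
      ((‖η‖ ^ δ : ℝ) : ℂ) * (((r ^ δ : ℝ) : ℂ) * mittagLeffler α 1 (-((r ^ k * σ η : ℝ) : ℂ))))
      {0}ᶜ x‖ ≤ C := by
  have hUD : UniqueDiffOn ℝ ({0}ᶜ : Set E) := isOpen_compl_singleton.uniqueDiffOn
  have hne : ∀ x : E, ‖x‖ = 1 → x ≠ 0 := fun x hx h => by simp [h] at hx
  -- Bounding 1/σ instead of minimizing σ also covers an empty sphere.
  obtain ⟨a, ha, hσa⟩ : ∃ a > 0, ∀ x, ‖x‖ = 1 → a ≤ σ x := by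
    obtain ⟨B, hB⟩ := (isCompact_sphere (0 : E) 1).exists_bound_of_continuousOn
      (f := fun x => (σ x)⁻¹) (ContinuousOn.inv₀
        (hσ.continuousOn.mono fun x hx => hne x (by simpa using hx))
        fun x hx => (hpos x (hne x (by simpa using hx))).ne')
    refine ⟨(|B| + 1)⁻¹, by positivity, fun x hx => ?_⟩
    have hσx := hpos x (hne x hx)
    refine inv_le_of_inv_le₀ hσx ?_
    have := (le_abs_self _).trans ((hB x (by simpa using hx)).trans (le_abs_self _))
    linarith
  obtain ⟨C₁, hC₁, hg⟩ := exists_bound_dilated_mittagLeffler hα₁ hα₂ hδ hδk ha n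
  obtain ⟨B₁, hB₁, hσB⟩ := exists_bound_iteratedFDerivWithin_sphere hσ n
  obtain ⟨B₂, hB₂, hnB⟩ := exists_bound_iteratedFDerivWithin_sphere
    (contDiffOn_norm_rpow (E := E) δ) n
  set D := (n.factorial : ℝ) * C₁ * B₁ ^ n
  have hD : 0 < D := by positivity
  refine ⟨2 ^ n * (B₂ * D), by positivity, fun i hi r hr x hx => ?_⟩
  have hgs : ContDiff ℝ ∞ fun s : ℝ =>
      ((r ^ δ : ℝ) : ℂ) * mittagLeffler α 1 (-((r ^ k * s : ℝ) : ℂ)) :=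
    contDiff_const.mul (contDiff_mittagLeffler_ofReal hα₁.le _)
  have hcomp : ∀ j ≤ n, ‖iteratedFDerivWithin ℝ j ((fun s : ℝ =>
      ((r ^ δ : ℝ) : ℂ) * mittagLeffler α 1 (-((r ^ k * s : ℝ) : ℂ))) ∘ σ) {0}ᶜ x‖ ≤ D := by
    intro j hj
    refine (norm_iteratedFDerivWithin_comp_le (t := Set.univ) (C := C₁) (D := B₁)
      hgs.contDiffOn hσ (by exact_mod_cast le_top) uniqueDiffOn_univ hUD (Set.mapsTo_univ _ _)
      (hne x hx) (fun l hl => ?_) (fun l hl hlj => ?_)).trans ?_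
    · rw [iteratedFDerivWithin_univ, norm_iteratedFDeriv_eq_norm_iteratedDeriv]
      exact hg l (hl.trans hj) r hr _ (hσa x hx)
    · exact (hσB l (hlj.trans hj) x hx).trans (le_self_pow₀ hB₁ (by omega))
    · have h1 : (j.factorial : ℝ) ≤ n.factorial := by exact_mod_cast Nat.factorial_le hj
      have h2 : B₁ ^ j ≤ B₁ ^ n := pow_le_pow_right₀ hB₁ hj
      simp only [D]
      gcongr
  refine (norm_iteratedFDerivWithin_mul_le (contDiffOn_norm_rpow δ)
    (hgs.comp_contDiffOn hσ) hUD (hne x hx) (n := i) (by exact_mod_cast le_top)).trans ?_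
  calc _ ≤ ∑ j ∈ Finset.range (i + 1), (i.choose j : ℝ) * B₂ * D := by
        refine Finset.sum_le_sum fun j hj => ?_
        have hji : j ≤ i := Nat.lt_succ_iff.1 (Finset.mem_range.1 hj)
        gcongr
        · exact hnB j (hji.trans hi) x hx
        · exact hcomp (i - j) ((Nat.sub_le _ _).trans hi)
    _ = 2 ^ i * (B₂ * D) := by
        rw [← Finset.sum_mul, ← Finset.sum_mul, mul_assoc]
        congr 1
        exact_mod_cast Nat.sum_range_choose i
    _ ≤ _ := by
        gcongr
        norm_num

/-! ### Scaling back from the sphere and conclusion -/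

theorem norm_iteratedFDeriv_comp_smul_le {E F : Type*} [NormedAddCommGroup E]
    [NormedSpace ℝ E] [NormedAddCommGroup F] [NormedSpace ℝ F] {f : E → F}
    (hf : ContDiffOn ℝ ∞ f {0}ᶜ) {c : ℝ} (hc : 0 < c) (n : ℕ) {x : E} (hx : x ≠ 0) :
    ‖iteratedFDeriv ℝ n (fun y => f (c • y)) x‖ ≤
      c ^ n * ‖iteratedFDerivWithin ℝ n f {0}ᶜ (c • x)‖ := by
  set S : E →L[ℝ] E := c • ContinuousLinearMap.id ℝ E with hS
  have hSn : ‖S‖ ≤ c := by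
    refine ContinuousLinearMap.opNorm_le_bound _ hc.le fun y => ?_
    simp [hS, norm_smul, abs_of_pos hc]
  have hpre : S ⁻¹' {0}ᶜ = {0}ᶜ := by
    ext y
    simp [hS, hc.ne']
  have hUD : UniqueDiffOn ℝ ({0}ᶜ : Set E) := isOpen_compl_singleton.uniqueDiffOn
  have hSx : S x ∈ ({0}ᶜ : Set E) := by simp [hS, hc.ne', hx]
  have h1 := S.iteratedFDerivWithin_comp_right (i := n) hf hUD (by rwa [hpre]) hSx
    (by exact_mod_cast le_top)
  rw [hpre, iteratedFDerivWithin_of_isOpen n isOpen_compl_singleton hx] at h1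
  change ‖iteratedFDeriv ℝ n (f ∘ S) x‖ ≤ c ^ n * ‖iteratedFDerivWithin ℝ n f {0}ᶜ (S x)‖
  rw [h1, mul_comm]
  refine (ContinuousMultilinearMap.norm_compContinuousLinearMap_le _ _).trans ?_
  rw [Finset.prod_const, Finset.card_univ, Fintype.card_fin]
  gcongr

theorem contDiffOn_norm_rpow_mul_mittagLeffler {E : Type*} [NormedAddCommGroup E]
    [InnerProductSpace ℝ E] {σ : E → ℝ} (hσ : ContDiffOn ℝ ∞ σ {0}ᶜ) {α : ℝ} (hα : 1 ≤ α)
    (δ c d : ℝ) :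
    ContDiffOn ℝ ∞ (fun η : E => ((‖η‖ ^ δ : ℝ) : ℂ) *
      ((d : ℂ) * mittagLeffler α 1 (-((c * σ η : ℝ) : ℂ)))) {0}ᶜ :=
  (contDiffOn_norm_rpow δ).mul (contDiffOn_const.mul
    ((contDiff_mittagLeffler_ofReal hα c).comp_contDiffOn hσ))

/-- The symbol `|ξ| ^ δ E_{α,1}(-σ(ξ))` satisfies Mikhlin-type bounds. -/
theorem exists_bound_iteratedFDeriv_symbol {E : Type*} [NormedAddCommGroup E]
    [InnerProductSpace ℝ E] [FiniteDimensional ℝ E] {σ : E → ℝ} (hσ : ContDiffOn ℝ ∞ σ {0}ᶜ)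
    (hpos : ∀ ξ, ξ ≠ 0 → 0 < σ ξ) {k : ℝ}
    (hhom : ∀ t : ℝ, 0 < t → ∀ ξ, ξ ≠ 0 → σ (t • ξ) = t ^ k * σ ξ)
    {α : ℝ} (hα₁ : 1 < α) (hα₂ : α < 2) {δ : ℝ} (hδ : 0 ≤ δ) (hδk : δ ≤ k) (n : ℕ) :
    ∃ C > 0, ∀ i ≤ n, ∀ ξ, ξ ≠ 0 → ‖iteratedFDeriv ℝ i (fun η : E =>
      ((‖η‖ ^ δ : ℝ) : ℂ) * mittagLeffler α 1 (-(σ η : ℂ))) ξ‖ ≤ C * ‖ξ‖ ^ (-(i : ℝ)) := by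
  obtain ⟨C, hC, hbound⟩ := exists_bound_dilated_symbol hσ hpos hα₁ hα₂ hδ hδk n
  refine ⟨C, hC, fun i hi ξ hξ => ?_⟩
  set r := ‖ξ‖ with hr
  have hr0 : 0 < r := norm_pos_iff.2 hξ
  -- Here r = |ξ| stays frozen while η varies, so the identity may be differentiated at ξ.
  have heq : (fun η : E => ((‖η‖ ^ δ : ℝ) : ℂ) * mittagLeffler α 1 (-(σ η : ℂ))) =ᶠ[nhds ξ]
      fun η => (fun η : E => ((‖η‖ ^ δ : ℝ) : ℂ) *
        (((r ^ δ : ℝ) : ℂ) * mittagLeffler α 1 (-((r ^ k * σ η : ℝ) : ℂ)))) (r⁻¹ • η) := by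
    filter_upwards [isOpen_compl_singleton.mem_nhds hξ] with η hη
    have h1 : r ^ k * σ (r⁻¹ • η) = σ η := by
      rw [← hhom r hr0 _ (smul_ne_zero (inv_ne_zero hr0.ne') hη), smul_inv_smul₀ hr0.ne']
    have h2 : ‖r⁻¹ • η‖ ^ δ * r ^ δ = ‖η‖ ^ δ := by
      rw [← Real.mul_rpow (norm_nonneg _) hr0.le, norm_smul, norm_inv, Real.norm_of_nonneg hr0.le]
      congr 1
      field_simp
    rw [h1, ← mul_assoc, ← Complex.ofReal_mul, h2]
  rw [(heq.iteratedFDeriv ℝ i).eq_of_nhds]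
  refine (norm_iteratedFDeriv_comp_smul_le
    (contDiffOn_norm_rpow_mul_mittagLeffler hσ hα₁.le δ _ _) (inv_pos.2 hr0) i hξ).trans ?_
  have h3 : ‖r⁻¹ • ξ‖ = 1 := by
    rw [norm_smul, norm_inv, Real.norm_of_nonneg hr0.le, ← hr, inv_mul_cancel₀ hr0.ne']
  have h4 := hbound i hi r hr0 (r⁻¹ • ξ) h3
  rw [Real.rpow_neg hr0.le, Real.rpow_natCast, inv_pow, mul_comm C]
  gcongr

theorem proposition4p2 (N : ℕ) (k : ℝ) (hk : 0 < k)
    (σ : EuclideanSpace ℝ (Fin N) → ℝ)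
    (hσ_smooth : ContDiffOn ℝ ∞ σ {0}ᶜ)
    (hσ_pos : ∀ ξ, ξ ≠ 0 → 0 < σ ξ)
    (hσ_hom : ∀ t : ℝ, 0 < t → ∀ ξ, ξ ≠ 0 → σ (t • ξ) = t ^ k * σ ξ)
    (α : ℝ) (hα₁ : 1 < α) (hα₂ : α < 2)
    (δ : ℝ) (hδ₀ : 0 ≤ δ) (hδk : δ < k) :
    ContDiffOn ℝ ∞ (fun ξ : EuclideanSpace ℝ (Fin N) =>
        ((‖ξ‖ ^ δ : ℝ) : ℂ) * mittagLeffler α 1 (-(σ ξ : ℂ))) {0}ᶜ ∧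
    ∃ C : ℝ, 0 < C ∧ ∀ A : ℝ,
      (∀ γ : Fin N → ℕ, ∑ i, γ i ≤ N / 2 + 1 → ∀ ξ, ξ ≠ 0 →
        |multiDeriv γ σ ξ| ≤ A * ‖ξ‖ ^ (k - ((∑ i, γ i : ℕ) : ℝ))) →
      ∀ γ : Fin N → ℕ, ∑ i, γ i ≤ N / 2 + 1 → ∀ ξ, ξ ≠ 0 →
        ‖multiDeriv γ (fun η : EuclideanSpace ℝ (Fin N) =>
            ((‖η‖ ^ δ : ℝ) : ℂ) * mittagLeffler α 1 (-(σ η : ℂ))) ξ‖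
          ≤ C * A * ‖ξ‖ ^ (-((∑ i, γ i : ℕ) : ℝ)) := by
  have hsmooth : ContDiffOn ℝ ∞ (fun ξ : EuclideanSpace ℝ (Fin N) =>
      ((‖ξ‖ ^ δ : ℝ) : ℂ) * mittagLeffler α 1 (-(σ ξ : ℂ))) {0}ᶜ := by
    simpa using contDiffOn_norm_rpow_mul_mittagLeffler hσ_smooth hα₁.le δ 1 1
  refine ⟨hsmooth, ?_⟩
  obtain ⟨C, hC, hbound⟩ := exists_bound_iteratedFDeriv_symbol hσ_smooth hσ_pos hσ_hom hα₁ hα₂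
    hδ₀ hδk.le (N / 2 + 1)
  -- For N = 0 there is no nonzero vector and the bound is vacuous.
  by_cases hne : ∃ e : EuclideanSpace ℝ (Fin N), e ≠ 0
  · obtain ⟨e, he⟩ := hne
    have hσe := hσ_pos e he
    have hek : 0 < ‖e‖ ^ k := Real.rpow_pos_of_pos (norm_pos_iff.2 he) k
    refine ⟨C * (‖e‖ ^ k / σ e), by positivity, fun A hA γ hγ ξ hξ => ?_⟩
    -- The case γ = 0 at e reads σ(e) ≤ A|e|^k, so the factor A can be inserted into a bound that
    -- does not involve it.
    have hA1 : 1 ≤ ‖e‖ ^ k / σ e * A := by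
      have h := hA 0 (by simp) e he
      have h0 : multiDeriv (0 : Fin N → ℕ) σ = σ := by
        simp [multiDeriv]
      rw [h0, abs_of_pos hσe] at h
      simp only [Pi.zero_apply, Finset.sum_const_zero, Nat.cast_zero, sub_zero] at h
      rw [div_mul_eq_mul_div, le_div_iff₀ hσe]
      linarith
    refine (norm_multiDeriv_le isOpen_compl_singleton hsmooth γ hξ).trans
      ((hbound _ hγ ξ hξ).trans ?_)
    rw [mul_assoc C]
    gcongr
    exact le_mul_of_one_le_right hC.le hA1
  · push Not at hne
    exact ⟨1, one_pos, fun A _ γ _ ξ hξ => absurd (hne ξ) hξ⟩
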